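/- Let $f\in C^1(\mathbb{R})$ satisfy $f(u)>0$ and $f'(u)\ge 0$ for all $u\in\mathbb{R}$, and let $\lambda>0$. For $L>0$ consider the Dirichlet problem $$u''(x)+\lambda f(u(x))=0 \ \text{ in } (0,L),\qquad u(0)=u(L)=0, \tag{D}$$ whose solutions are functions $u\in C^2((0,L))\cap C([0,L])$. Set $F(u)=\int_0^u f(s)\,ds$, $g(u)=f(u)^2-2f'(u)F(u)$, and, for $C>0$, $$L(C)=\frac{1}{\sqrt{\lambda}}\int_{-\sqrt{2C}}^{\sqrt{2C}}\frac{dv}{f\left(F^{-1}\left(C-\frac{v^2}{2}\right)\right)} .$$ (i) If $g(u)>0$ for all $u\in(0,\infty)$, then $C\mapsto L(C)$ is strictly increasing on $(0,\infty)$, and for every $L>0$ problem (D) has at most one solution. (ii) If $f\in C^2(\mathbb{R})$ and $f''(u)>0$ for all $u>0$, then for every $L>0$ problem (D) has at most two solutions. The solutions are ordered: if $u_1\ne u_2$ are solutions of (D), then either $u_1<u_2$ on $(0,L)$ or $u_2<u_1$ on $(0,L)$. -/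

import Mathlib

/-- The primitive `F(u) = ∫₀ᵘ f(s) ds`. -/
noncomputable def primitive (f : ℝ → ℝ) (u : ℝ) : ℝ :=
  ∫ s in (0 : ℝ)..u, f s

/-- The function `g(u) = f(u)² - 2 f'(u) F(u)`. -/
noncomputable def gFun (f : ℝ → ℝ) (u : ℝ) : ℝ :=
  f u ^ 2 - 2 * deriv f u * primitive f u

/-- The time map
`L(C) = λ^(-1/2) ∫_{-√(2C)}^{√(2C)} dv / f(F⁻¹(C - v²/2))`
of the Dirichlet problem. If `f` is positive and nondecreasing then `F` is injective and its range
contains `[0, ∞)`, so that `Function.invFun` is the inverse of `F` at all points used here. -/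
noncomputable def timeMap (f : ℝ → ℝ) (lam C : ℝ) : ℝ :=
  (1 / √lam) * ∫ v in (-√(2 * C))..(√(2 * C)),
    1 / f (Function.invFun (primitive f) (C - v ^ 2 / 2))

/-- `u` is a classical solution of `u'' + λ f(u) = 0` in `(0, L)`, `u(0) = u(L) = 0`.
Only the values of `u` on `[0, L]` matter. -/
structure IsDirichletSolution (f : ℝ → ℝ) (lam L : ℝ) (u : ℝ → ℝ) : Prop where
  continuousOn : ContinuousOn u (Set.Icc 0 L)
  contDiffOn : ContDiffOn ℝ 2 u (Set.Ioo 0 L)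
  equation : ∀ x ∈ Set.Ioo 0 L, deriv (deriv u) x + lam * f (u x) = 0
  left_eq : u 0 = 0
  right_eq : u L = 0

/-! In terms of `v = u' / √λ`, a solution conserves the energy `v²/2 + F(u)`, with `F` strictly
increasing, and `v` decreases from `v(0) > 0` to `-v(0)`. Taking `v` as the independent variable
gives `L = L(C)` with `C = v(0)²/2`. The substitution `v = √(2C) t` turns `L(C)` into an integral
over `[-1, 1]` whose integrand increases with `C` as soon as `F / f²` is increasing, and the
derivative of `F / f²` is `g / f³`.

Two solutions are compared at the interior extrema of `u₂ - u₁`: there `v₁ = v₂`, so the energies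
differ by `F(u₂) - F(u₁)` alone, and the sign of `u₂ - u₁` is that of `v₂(0) - v₁(0)`. Hence a
solution is determined by `v(0)`, and solutions are ordered as their values of `v(0)`.
If `f` is strictly convex, three solutions `u₁ < u₂ < u₃` are impossible by Sturm comparison:
`u₂ - u₁` and `u₃ - u₂` would be positive solutions, vanishing at both ends, of `p'' + a p = 0` and
`q'' + b q = 0`, where `a < b` are the secant slopes of `λ f`. -/

open Set

/-- A trajectory of the phase plane system `u' = μ v`, `v' = -μ f(u)` over `[0, L]` with `u = 0` at
both ends: the first order form of the Dirichlet problem with `λ = μ²`. With this normalization of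
the velocity the conserved energy `v²/2 + F(u)` does not involve `μ`. The equations are required
only inside the interval, so that `u` can be a Dirichlet solution itself. -/
structure IsPhaseSolution (f : ℝ → ℝ) (μ L : ℝ) (u v : ℝ → ℝ) : Prop where
  continuousOn_fst : ContinuousOn u (Icc 0 L)
  continuousOn_snd : ContinuousOn v (Icc 0 L)
  hasDerivAt_fst : ∀ x ∈ Ioo 0 L, HasDerivAt u (μ * v x) x
  hasDerivAt_snd : ∀ x ∈ Ioo 0 L, HasDerivAt v (-(μ * f (u x))) x
  left_eq : u 0 = 0
  right_eq : u L = 0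

theorem nonneg_of_forall_deriv_eq_zero {φ : ℝ → ℝ} {a b : ℝ} (hφ : ContinuousOn φ (Icc a b))
    (ha : 0 ≤ φ a) (hb : 0 ≤ φ b) (hcrit : ∀ x ∈ Ioo a b, deriv φ x = 0 → 0 ≤ φ x)
    {x : ℝ} (hx : x ∈ Icc a b) : 0 ≤ φ x := by
  obtain ⟨z, hz, hmin⟩ := isCompact_Icc.exists_isMinOn ⟨x, hx⟩ hφ
  suffices 0 ≤ φ z from this.trans (hmin hx)
  rcases eq_endpoints_or_mem_Ioo_of_mem_Icc hz with rfl | rfl | hz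
  · exact ha
  · exact hb
  · exact hcrit z hz (hmin.isLocalMin (Icc_mem_nhds hz.1 hz.2)).deriv_eq_zero

theorem eq_or_eq_or_eq_of_not_lt_lt {α : Type*} [LinearOrder α] {s : Set α}
    (hs : ∀ a ∈ s, ∀ b ∈ s, ∀ c ∈ s, a < b → ¬ b < c) {a b c : α}
    (ha : a ∈ s) (hb : b ∈ s) (hc : c ∈ s) : a = b ∨ a = c ∨ b = c := by
  rcases lt_trichotomy a b with hab | hab | hab <;>
  rcases lt_trichotomy b c with hbc | hbc | hbc <;>
  rcases lt_trichotomy a c with hac | hac | hac <;>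
  grind

theorem continuousOn_invFun_range {α β : Type*} [LinearOrder α] [TopologicalSpace α]
    [OrderTopology α] [PreconnectedSpace α] [Nonempty α] [LinearOrder β] [TopologicalSpace β]
    [OrderTopology β] {F : α → β} (hF : Continuous F) (hmono : StrictMono F) :
    ContinuousOn (Function.invFun F) (range F) := by
  have hemb := hmono.isEmbedding_of_ordConnected (isPreconnected_range hF).ordConnected
  rw [hemb.isInducing.continuousOn_iff]
  exact continuousOn_id.congr fun _ hy => Function.invFun_eq hy

section Primitive

variable {f : ℝ → ℝ}

theorem primitive_zero (f : ℝ → ℝ) : primitive f 0 = 0 :=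
  intervalIntegral.integral_same

theorem hasDerivAt_primitive (hf : Continuous f) (u : ℝ) : HasDerivAt (primitive f) (f u) u :=
  (hf.integral_hasStrictDerivAt 0 u).hasDerivAt

theorem continuous_primitive (hf : Continuous f) : Continuous (primitive f) :=
  continuous_iff_continuousAt.2 fun u => (hasDerivAt_primitive hf u).continuousAt

theorem strictMono_primitive (hf : Continuous f) (hpos : ∀ u, 0 < f u) :
    StrictMono (primitive f) :=
  strictMono_of_hasDerivAt_pos (hasDerivAt_primitive hf) hpos

theorem invFun_primitive (hf : Continuous f) (hpos : ∀ u, 0 < f u) (u : ℝ) :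
    Function.invFun (primitive f) (primitive f u) = u :=
  Function.leftInverse_invFun (strictMono_primitive hf hpos).injective u

theorem primitive_nonneg (hf : Continuous f) (hpos : ∀ u, 0 < f u) {u : ℝ} (hu : 0 ≤ u) :
    0 ≤ primitive f u :=
  primitive_zero f ▸ (strictMono_primitive hf hpos).monotone hu

theorem Icc_zero_primitive_subset_image (hf : Continuous f) {u : ℝ} (hu : 0 ≤ u) :
    Icc 0 (primitive f u) ⊆ primitive f '' Icc 0 u := by
  simpa only [primitive_zero] using
    intermediate_value_Icc hu (continuous_primitive hf).continuousOn

theorem mul_le_primitive (hf : Continuous f) (hmono : Monotone f) {u : ℝ} (hu : 0 ≤ u) :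
    f 0 * u ≤ primitive f u :=
  calc f 0 * u = ∫ _ in (0 : ℝ)..u, f 0 := by
        rw [intervalIntegral.integral_const, sub_zero, smul_eq_mul, mul_comm]
    _ ≤ primitive f u := intervalIntegral.integral_mono_on hu intervalIntegrable_const
        (hf.intervalIntegrable 0 u) fun s hs => hmono hs.1

theorem Ioi_zero_subset_image_primitive (hf : Continuous f) (hpos : ∀ u, 0 < f u)
    (hmono : Monotone f) : Ioi 0 ⊆ primitive f '' Ioi 0 := by
  intro w (hw : 0 < w)
  have hw' : 0 ≤ w / f 0 := (div_pos hw (hpos 0)).le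
  have hle : w ≤ primitive f (w / f 0) := by
    simpa only [mul_div_cancel₀ w (hpos 0).ne'] using mul_le_primitive hf hmono hw'
  obtain ⟨u, hu, rfl⟩ := Icc_zero_primitive_subset_image hf hw' ⟨hw.le, hle⟩
  refine ⟨u, hu.1.lt_of_ne ?_, rfl⟩
  rintro rfl
  exact hw.ne' (primitive_zero f)

theorem continuousOn_one_div_comp_invFun_primitive (hf : Continuous f) (hpos : ∀ u, 0 < f u)
    {w : ℝ → ℝ} {s : Set ℝ} (hw : ContinuousOn w s) (hs : MapsTo w s (range (primitive f))) :
    ContinuousOn (fun x => 1 / f (Function.invFun (primitive f) (w x))) s :=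
  continuousOn_const.div
    (hf.comp_continuousOn ((continuousOn_invFun_range (continuous_primitive hf)
      (strictMono_primitive hf hpos)).comp hw hs))
    fun _ _ => (hpos _).ne'

end Primitive

section TimeMap

variable {f : ℝ → ℝ}

theorem strictMonoOn_primitive_div_sq (hf : Differentiable ℝ f) (hpos : ∀ u, 0 < f u)
    (hg : ∀ u, 0 < u → 0 < gFun f u) :
    StrictMonoOn (fun u => primitive f u / f u ^ 2) (Ici 0) := by
  have hderiv (u : ℝ) :
      HasDerivAt (fun u => primitive f u / f u ^ 2) (gFun f u / f u ^ 3) u := by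
    have hfu := (hpos u).ne'
    refine ((hasDerivAt_primitive hf.continuous u).fun_div ((hf u).hasDerivAt.fun_pow 2)
      (pow_ne_zero 2 hfu)).congr_deriv ?_
    simp only [gFun]
    field_simp
    push_cast
    ring
  refine strictMonoOn_of_deriv_pos (convex_Ici 0)
    (fun u _ => (hderiv u).continuousAt.continuousWithinAt) fun u hu => ?_
  rw [interior_Ici] at hu
  rw [(hderiv u).deriv]
  exact div_pos (hg u hu) (pow_pos (hpos u) 3)

theorem strictMonoOn_sqrt_div_comp_invFun_primitive (hf : Differentiable ℝ f)
    (hpos : ∀ u, 0 < f u) (hg : ∀ u, 0 < u → 0 < gFun f u) :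
    StrictMonoOn (fun w => √w / f (Function.invFun (primitive f) w)) (primitive f '' Ici 0) := by
  have hF := strictMono_primitive hf.continuous hpos
  rintro _ ⟨a, ha, rfl⟩ _ ⟨b, hb, rfl⟩ hab
  have hlt := strictMonoOn_primitive_div_sq hf hpos hg ha hb (hF.lt_iff_lt.1 hab)
  have ha' := primitive_nonneg hf.continuous hpos ha
  simpa only [invFun_primitive hf.continuous hpos, Real.sqrt_div' _ (sq_nonneg _),
    Real.sqrt_sq (hpos _).le] using Real.sqrt_lt_sqrt (div_nonneg ha' (sq_nonneg _)) hlt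

theorem strictMonoOn_timeMap_integrand_unit (hf : Differentiable ℝ f) (hpos : ∀ u, 0 < f u)
    (hg : ∀ u, 0 < u → 0 < gFun f u) {s : ℝ} (hs : 0 < s) (hs' : s ≤ 1) :
    StrictMonoOn (fun C => √(2 * C) * (1 / f (Function.invFun (primitive f) (C * s))))
      (primitive f '' Ioi 0) := by
  rintro _ ⟨a, ha, rfl⟩ _ ⟨b, hb, rfl⟩ hab
  have hmem {c : ℝ} (hc : 0 < c) : primitive f c * s ∈ primitive f '' Ici 0 := by
    have hFc := primitive_nonneg hf.continuous hpos hc.le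
    exact image_mono Icc_subset_Ici_self (Icc_zero_primitive_subset_image hf.continuous hc.le
      ⟨mul_nonneg hFc hs.le, mul_le_of_le_one_right hFc hs'⟩)
  have hscale (C : ℝ) : √(2 * C) = √(2 / s) * √(C * s) := by
    rw [← Real.sqrt_mul (by positivity)]
    congr 1
    field_simp
  simp only [hscale, mul_one_div, mul_div_assoc]
  exact mul_lt_mul_of_pos_left (strictMonoOn_sqrt_div_comp_invFun_primitive hf hpos hg (hmem ha)
    (hmem hb) (mul_lt_mul_of_pos_right hab hs)) (Real.sqrt_pos.2 (by positivity))

theorem timeMap_eq_integral_unit (lam : ℝ) {C : ℝ} (hC : 0 ≤ C) :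
    timeMap f lam C = (1 / √lam) * ∫ t in (-1 : ℝ)..1,
      √(2 * C) * (1 / f (Function.invFun (primitive f) (C * (1 - t ^ 2)))) := by
  have hsubst := intervalIntegral.smul_integral_comp_mul_left (a := -1) (b := 1)
    (fun v => 1 / f (Function.invFun (primitive f) (C - v ^ 2 / 2))) √(2 * C)
  have harg (t : ℝ) : C - (√(2 * C) * t) ^ 2 / 2 = C * (1 - t ^ 2) := by
    rw [mul_pow, Real.sq_sqrt (by positivity)]
    ring
  simp only [harg, mul_neg, mul_one, smul_eq_mul] at hsubst
  rw [timeMap, ← hsubst, intervalIntegral.integral_const_mul]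

theorem intervalIntegrable_timeMap_unit (hf : Continuous f) (hpos : ∀ u, 0 < f u) {α : ℝ}
    (hα : 0 ≤ α) :
    IntervalIntegrable (fun t : ℝ => √(2 * primitive f α) *
      (1 / f (Function.invFun (primitive f) (primitive f α * (1 - t ^ 2)))))
      MeasureTheory.volume (-1) 1 := by
  refine ((continuousOn_one_div_comp_invFun_primitive hf hpos (by fun_prop)
    fun t ht => ?_).const_smul √(2 * primitive f α)).intervalIntegrable
  rw [uIcc_of_le (by norm_num)] at ht
  have hα' := primitive_nonneg hf hpos hα
  have ht' : t ^ 2 ≤ 1 := sq_le_one_iff_abs_le_one t |>.2 (abs_le.2 ht)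
  exact image_subset_range _ _ (Icc_zero_primitive_subset_image hf hα
    ⟨by nlinarith, by nlinarith [sq_nonneg t]⟩)

theorem strictMonoOn_timeMap (hf : Differentiable ℝ f) (hpos : ∀ u, 0 < f u)
    (hg : ∀ u, 0 < u → 0 < gFun f u) {lam : ℝ} (hlam : 0 < lam) :
    StrictMonoOn (timeMap f lam) (primitive f '' Ioi 0) := by
  rintro _ ⟨a, ha, rfl⟩ _ ⟨b, hb, rfl⟩ hab
  have ha' := primitive_nonneg hf.continuous hpos (le_of_lt ha)
  have hb' := primitive_nonneg hf.continuous hpos (le_of_lt hb)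
  rw [timeMap_eq_integral_unit lam ha', timeMap_eq_integral_unit lam hb']
  have ha_int := intervalIntegrable_timeMap_unit hf.continuous hpos (le_of_lt ha)
  have hb_int := intervalIntegrable_timeMap_unit hf.continuous hpos (le_of_lt hb)
  refine mul_lt_mul_of_pos_left ?_ (one_div_pos.2 (Real.sqrt_pos.2 hlam))
  rw [← sub_pos, ← intervalIntegral.integral_sub hb_int ha_int]
  refine intervalIntegral.intervalIntegral_pos_of_pos_on (hb_int.sub ha_int) (fun t ht => ?_)
    (by norm_num)
  exact sub_pos.2 (strictMonoOn_timeMap_integrand_unit hf hpos hg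
    (sub_pos.2 (sq_lt_one_iff_abs_lt_one t |>.2 (abs_lt.2 ht))) (sub_le_self 1 (sq_nonneg t))
    ⟨a, ha, rfl⟩ ⟨b, hb, rfl⟩ hab)

end TimeMap

namespace IsPhaseSolution

variable {f : ℝ → ℝ} {μ L : ℝ} {u v u₁ v₁ u₂ v₂ u₃ v₃ : ℝ → ℝ}

theorem energy_eq (hf : Continuous f) (h : IsPhaseSolution f μ L u v) {x : ℝ}
    (hx : x ∈ Icc 0 L) : v x ^ 2 / 2 + primitive f (u x) = v 0 ^ 2 / 2 := by
  have hcont : ContinuousOn (fun y => v y ^ 2 / 2 + primitive f (u y)) (Icc 0 L) :=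
    ((h.continuousOn_snd.pow 2).div_const 2).add
      ((continuous_primitive hf).comp_continuousOn h.continuousOn_fst)
  have hderiv : ∀ y ∈ Ioo 0 L,
      HasDerivAt (fun y => v y ^ 2 / 2 + primitive f (u y)) 0 y := by
    intro y hy
    refine ((((h.hasDerivAt_snd y hy).fun_pow 2).div_const 2).add
      ((hasDerivAt_primitive hf (u y)).comp y (h.hasDerivAt_fst y hy))).congr_deriv ?_
    push_cast
    ring
  have hconst := intervalIntegral.integral_eq_sub_of_hasDerivAt_of_le hx.1
    (hcont.mono (Icc_subset_Icc_right hx.2))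
    (fun y hy => hderiv y ⟨hy.1, hy.2.trans_le hx.2⟩) intervalIntegrable_const
  rw [intervalIntegral.integral_zero, h.left_eq, primitive_zero] at hconst
  linarith

theorem strictAntiOn_snd (hpos : ∀ u, 0 < f u) (hμ : 0 < μ) (h : IsPhaseSolution f μ L u v) :
    StrictAntiOn v (Icc 0 L) := by
  refine strictAntiOn_of_deriv_neg (convex_Icc 0 L) h.continuousOn_snd fun x hx => ?_
  rw [interior_Icc] at hx
  rw [(h.hasDerivAt_snd x hx).deriv]
  exact neg_neg_of_pos (mul_pos hμ (hpos _))

theorem snd_right_eq (hf : Continuous f) (hpos : ∀ u, 0 < f u) (hμ : 0 < μ) (hL : 0 < L)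
    (h : IsPhaseSolution f μ L u v) : v L = -v 0 := by
  have henergy := h.energy_eq hf (right_mem_Icc.2 hL.le)
  rw [h.right_eq, primitive_zero] at henergy
  have hlt := h.strictAntiOn_snd hpos hμ (left_mem_Icc.2 hL.le) (right_mem_Icc.2 hL.le) hL
  exact (sq_eq_sq_iff_eq_or_eq_neg.1 (by linarith)).resolve_left hlt.ne

theorem snd_zero_pos (hf : Continuous f) (hpos : ∀ u, 0 < f u) (hμ : 0 < μ) (hL : 0 < L)
    (h : IsPhaseSolution f μ L u v) : 0 < v 0 := by
  have hlt := h.strictAntiOn_snd hpos hμ (left_mem_Icc.2 hL.le) (right_mem_Icc.2 hL.le) hL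
  rw [h.snd_right_eq hf hpos hμ hL] at hlt
  linarith

theorem fst_nonneg (hf : Continuous f) (hpos : ∀ u, 0 < f u) (hμ : μ ≠ 0)
    (h : IsPhaseSolution f μ L u v) {x : ℝ} (hx : x ∈ Icc 0 L) : 0 ≤ u x := by
  refine nonneg_of_forall_deriv_eq_zero h.continuousOn_fst h.left_eq.ge h.right_eq.ge
    (fun y hy hy' => ?_) hx
  rw [(h.hasDerivAt_fst y hy).deriv, mul_eq_zero_iff_left hμ] at hy'
  have henergy := h.energy_eq hf (Ioo_subset_Icc_self hy)
  rw [hy'] at henergy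
  rw [← (strictMono_primitive hf hpos).le_iff_le, primitive_zero]
  linarith [sq_nonneg (v 0)]

theorem energy_mem_image_primitive (hf : Continuous f) (hpos : ∀ u, 0 < f u) (hμ : 0 < μ)
    (hL : 0 < L) (h : IsPhaseSolution f μ L u v) : v 0 ^ 2 / 2 ∈ primitive f '' Ioi 0 := by
  have hv := h.snd_zero_pos hf hpos hμ hL
  obtain ⟨x, hx, hvx⟩ := intermediate_value_Icc' hL.le h.continuousOn_snd
    ⟨by linarith [h.snd_right_eq hf hpos hμ hL], hv.le⟩
  have henergy := h.energy_eq hf hx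
  rw [hvx, zero_pow two_ne_zero, zero_div, zero_add] at henergy
  refine ⟨u x, ?_, henergy⟩
  rw [mem_Ioi, ← (strictMono_primitive hf hpos).lt_iff_lt, primitive_zero, henergy]
  positivity

/-- Substitute `w = v(x)`: by conservation of energy the integrand of the time map at `v(x)` is
`1 / f(u(x))`, which cancels the factor `f(u(x))` of `v'(x)`. -/
theorem timeMap_eq {lam : ℝ} (hf : Continuous f) (hpos : ∀ u, 0 < f u) (hlam : 0 < lam)
    (hL : 0 < L) (h : IsPhaseSolution f √lam L u v) : timeMap f lam (v 0 ^ 2 / 2) = L := by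
  have hμ : 0 < √lam := Real.sqrt_pos.2 hlam
  have hF : ∀ x ∈ Icc 0 L, v 0 ^ 2 / 2 - v x ^ 2 / 2 = primitive f (u x) :=
    fun x hx => by linarith [h.energy_eq hf hx]
  let G : ℝ → ℝ := fun w => 1 / f (Function.invFun (primitive f) (v 0 ^ 2 / 2 - w ^ 2 / 2))
  have hG : ContinuousOn G (v '' Icc 0 L) := by
    refine continuousOn_one_div_comp_invFun_primitive hf hpos (by fun_prop) ?_
    rintro _ ⟨x, hx, rfl⟩
    exact ⟨u x, (hF x hx).symm⟩
  have hintegrand : ∀ x ∈ Icc 0 L, (G ∘ v) x * -(√lam * f (u x)) = -√lam := by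
    intro x hx
    have := (hpos (u x)).ne'
    simp only [G, Function.comp_apply, hF x hx, invFun_primitive hf hpos]
    field_simp
  have hsubst : ∫ x in (0 : ℝ)..L, (G ∘ v) x * -(√lam * f (u x)) = ∫ w in v 0..v L, G w := by
    rw [← uIcc_of_le hL.le] at hG
    refine intervalIntegral.integral_comp_mul_deriv'' ?_ (fun x hx => ?_) ?_ hG
    · simpa only [uIcc_of_le hL.le] using h.continuousOn_snd
    · rw [min_eq_left hL.le, max_eq_right hL.le] at hx
      exact (h.hasDerivAt_snd x hx).hasDerivWithinAt
    · rw [uIcc_of_le hL.le]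
      exact (continuousOn_const.mul (hf.comp_continuousOn h.continuousOn_fst)).neg
  have hroot : √(2 * (v 0 ^ 2 / 2)) = v 0 := by
    rw [mul_div_cancel₀ _ two_ne_zero, Real.sqrt_sq (h.snd_zero_pos hf hpos hμ hL).le]
  calc timeMap f lam (v 0 ^ 2 / 2) = (1 / √lam) * -∫ w in v 0..v L, G w := by
        rw [timeMap, hroot, h.snd_right_eq hf hpos hμ hL, intervalIntegral.integral_symm]
    _ = (1 / √lam) * -∫ _ in (0 : ℝ)..L, -√lam := by
        rw [← hsubst, intervalIntegral.integral_congr fun x hx =>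
          hintegrand x (uIcc_of_le hL.le ▸ hx)]
    _ = L := by
        rw [intervalIntegral.integral_const, smul_eq_mul]
        field_simp
        ring

theorem fst_le_of_snd_zero_le (hf : Continuous f) (hpos : ∀ u, 0 < f u) (hμ : 0 < μ) (hL : 0 < L)
    (h₁ : IsPhaseSolution f μ L u₁ v₁) (h₂ : IsPhaseSolution f μ L u₂ v₂) (h0 : v₁ 0 ≤ v₂ 0)
    {x : ℝ} (hx : x ∈ Icc 0 L) : u₁ x ≤ u₂ x := by
  rw [← sub_nonneg]
  refine nonneg_of_forall_deriv_eq_zero (φ := fun y => u₂ y - u₁ y)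
    (h₂.continuousOn_fst.sub h₁.continuousOn_fst) (by simp [h₁.left_eq, h₂.left_eq])
    (by simp [h₁.right_eq, h₂.right_eq]) (fun y hy hy' => ?_) hx
  rw [((h₂.hasDerivAt_fst y hy).fun_sub (h₁.hasDerivAt_fst y hy)).deriv, sub_eq_zero,
    mul_right_inj' hμ.ne'] at hy'
  have e₁ := h₁.energy_eq hf (Ioo_subset_Icc_self hy)
  have e₂ := h₂.energy_eq hf (Ioo_subset_Icc_self hy)
  have hsq := pow_le_pow_left₀ (h₁.snd_zero_pos hf hpos hμ hL).le h0 2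
  rw [sub_nonneg, ← (strictMono_primitive hf hpos).le_iff_le]
  rw [hy'] at e₂
  linarith

theorem fst_lt_of_snd_zero_lt (hf : Continuous f) (hpos : ∀ u, 0 < f u) (hμ : 0 < μ) (hL : 0 < L)
    (h₁ : IsPhaseSolution f μ L u₁ v₁) (h₂ : IsPhaseSolution f μ L u₂ v₂) (h0 : v₁ 0 < v₂ 0)
    {x : ℝ} (hx : x ∈ Ioo 0 L) : u₁ x < u₂ x := by
  have hle : ∀ y ∈ Icc 0 L, u₁ y ≤ u₂ y := fun y hy =>
    h₁.fst_le_of_snd_zero_le hf hpos hμ hL h₂ h0.le hy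
  refine (hle x (Ioo_subset_Icc_self hx)).lt_of_ne fun hux => ?_
  have hmin : IsLocalMin (fun y => u₂ y - u₁ y) x := by
    filter_upwards [Icc_mem_nhds hx.1 hx.2] with y hy
    linarith [hle y hy]
  have hv : v₂ x = v₁ x := by
    have := hmin.hasDerivAt_eq_zero ((h₂.hasDerivAt_fst x hx).fun_sub (h₁.hasDerivAt_fst x hx))
    rwa [sub_eq_zero, mul_right_inj' hμ.ne'] at this
  have e₁ := h₁.energy_eq hf (Ioo_subset_Icc_self hx)
  have e₂ := h₂.energy_eq hf (Ioo_subset_Icc_self hx)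
  have hsq := pow_lt_pow_left₀ h0 (h₁.snd_zero_pos hf hpos hμ hL).le two_ne_zero
  rw [hux] at e₁
  rw [hv] at e₂
  linarith

theorem eqOn_of_snd_zero_eq (hf : Continuous f) (hpos : ∀ u, 0 < f u) (hμ : 0 < μ) (hL : 0 < L)
    (h₁ : IsPhaseSolution f μ L u₁ v₁) (h₂ : IsPhaseSolution f μ L u₂ v₂) (h0 : v₁ 0 = v₂ 0) :
    EqOn u₁ u₂ (Icc 0 L) := fun _ hx =>
  (h₁.fst_le_of_snd_zero_le hf hpos hμ hL h₂ h0.le hx).antisymm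
    (h₂.fst_le_of_snd_zero_le hf hpos hμ hL h₁ h0.ge hx)

theorem snd_zero_eq_of_injOn_timeMap {lam : ℝ} (hf : Continuous f) (hpos : ∀ u, 0 < f u)
    (hlam : 0 < lam) (hL : 0 < L) (hT : InjOn (timeMap f lam) (primitive f '' Ioi 0))
    (h₁ : IsPhaseSolution f √lam L u₁ v₁) (h₂ : IsPhaseSolution f √lam L u₂ v₂) :
    v₁ 0 = v₂ 0 := by
  have hμ : 0 < √lam := Real.sqrt_pos.2 hlam
  have henergy : v₁ 0 ^ 2 / 2 = v₂ 0 ^ 2 / 2 :=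
    hT (h₁.energy_mem_image_primitive hf hpos hμ hL) (h₂.energy_mem_image_primitive hf hpos hμ hL)
      ((h₁.timeMap_eq hf hpos hlam hL).trans (h₂.timeMap_eq hf hpos hlam hL).symm)
  rwa [div_left_inj' two_ne_zero, pow_left_inj₀ (h₁.snd_zero_pos hf hpos hμ hL).le
    (h₂.snd_zero_pos hf hpos hμ hL).le two_ne_zero] at henergy

theorem hasDerivAt_wronskian_sub (h₁ : IsPhaseSolution f μ L u₁ v₁)
    (h₂ : IsPhaseSolution f μ L u₂ v₂) (h₃ : IsPhaseSolution f μ L u₃ v₃) {x : ℝ}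
    (hx : x ∈ Ioo 0 L) :
    HasDerivAt (fun x => (v₂ x - v₁ x) * (u₃ x - u₂ x) - (u₂ x - u₁ x) * (v₃ x - v₂ x))
      (μ * ((u₂ x - u₁ x) * (f (u₃ x) - f (u₂ x)) - (f (u₂ x) - f (u₁ x)) * (u₃ x - u₂ x))) x := by
  have du₁₂ := (h₂.hasDerivAt_fst x hx).fun_sub (h₁.hasDerivAt_fst x hx)
  have du₂₃ := (h₃.hasDerivAt_fst x hx).fun_sub (h₂.hasDerivAt_fst x hx)
  have dv₁₂ := (h₂.hasDerivAt_snd x hx).fun_sub (h₁.hasDerivAt_snd x hx)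
  have dv₂₃ := (h₃.hasDerivAt_snd x hx).fun_sub (h₂.hasDerivAt_snd x hx)
  refine ((dv₁₂.fun_mul du₂₃).fun_sub (du₁₂.fun_mul dv₂₃)).congr_deriv ?_
  ring

/-- The Wronskian of `u₂ - u₁` and `u₃ - u₂` vanishes at both ends, but strict convexity makes its
derivative positive. -/
theorem not_lt_lt {s : Set ℝ} (hconv : StrictConvexOn ℝ s f) (hμ : μ ≠ 0) (hL : 0 < L)
    (h₁ : IsPhaseSolution f μ L u₁ v₁) (h₂ : IsPhaseSolution f μ L u₂ v₂)
    (h₃ : IsPhaseSolution f μ L u₃ v₃) (hs₁ : MapsTo u₁ (Ioo 0 L) s)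
    (hs₃ : MapsTo u₃ (Ioo 0 L) s) (h₁₂ : ∀ x ∈ Ioo 0 L, u₁ x < u₂ x) :
    ¬ ∀ x ∈ Ioo 0 L, u₂ x < u₃ x := by
  intro h₂₃
  obtain ⟨c, hc, hc'⟩ := exists_hasDerivAt_eq_zero hL
    (((h₂.continuousOn_snd.sub h₁.continuousOn_snd).mul
      (h₃.continuousOn_fst.sub h₂.continuousOn_fst)).sub
      ((h₂.continuousOn_fst.sub h₁.continuousOn_fst).mul
        (h₃.continuousOn_snd.sub h₂.continuousOn_snd)))
    (by simp [h₁.left_eq, h₂.left_eq, h₃.left_eq, h₁.right_eq, h₂.right_eq, h₃.right_eq])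
    (fun x hx => h₁.hasDerivAt_wronskian_sub h₂ h₃ hx)
  have hslope := hconv.slope_strict_mono_adjacent (hs₁ hc) (hs₃ hc) (h₁₂ c hc) (h₂₃ c hc)
  rw [div_lt_div_iff₀ (sub_pos.2 (h₁₂ c hc)) (sub_pos.2 (h₂₃ c hc))] at hslope
  rw [mul_eq_zero_iff_left hμ] at hc'
  linarith

theorem snd_zero_eq_or_eq_or_eq (hf : Continuous f) (hpos : ∀ u, 0 < f u)
    (hconv : StrictConvexOn ℝ (Ici 0) f) (hμ : 0 < μ) (hL : 0 < L)
    (h₁ : IsPhaseSolution f μ L u₁ v₁) (h₂ : IsPhaseSolution f μ L u₂ v₂)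
    (h₃ : IsPhaseSolution f μ L u₃ v₃) : v₁ 0 = v₂ 0 ∨ v₁ 0 = v₃ 0 ∨ v₂ 0 = v₃ 0 := by
  refine eq_or_eq_or_eq_of_not_lt_lt (s := {a | ∃ u v, IsPhaseSolution f μ L u v ∧ v 0 = a}) ?_
    ⟨u₁, v₁, h₁, rfl⟩ ⟨u₂, v₂, h₂, rfl⟩ ⟨u₃, v₃, h₃, rfl⟩
  rintro _ ⟨u, v, h, rfl⟩ _ ⟨u', v', h', rfl⟩ _ ⟨u'', v'', h'', rfl⟩ hlt hlt'
  exact h.not_lt_lt hconv hμ.ne' hL h' h''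
    (fun x hx => h.fst_nonneg hf hpos hμ.ne' (Ioo_subset_Icc_self hx))
    (fun x hx => h''.fst_nonneg hf hpos hμ.ne' (Ioo_subset_Icc_self hx))
    (fun x hx => h.fst_lt_of_snd_zero_lt hf hpos hμ hL h' hlt hx)
    (fun x hx => h'.fst_lt_of_snd_zero_lt hf hpos hμ hL h'' hlt' hx)

end IsPhaseSolution

namespace IsDirichletSolution

variable {f : ℝ → ℝ} {lam L : ℝ} {u : ℝ → ℝ}

theorem hasDerivAt_deriv (h : IsDirichletSolution f lam L u) {x : ℝ} (hx : x ∈ Ioo 0 L) :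
    HasDerivAt (deriv u) (-(lam * f (u x))) x := by
  have hdiff : DifferentiableOn ℝ (deriv u) (Ioo 0 L) :=
    (h.contDiffOn.deriv_of_isOpen isOpen_Ioo (m := 1) (by norm_num)).differentiableOn one_ne_zero
  rw [← eq_neg_of_add_eq_zero_left (h.equation x hx)]
  exact (hdiff.differentiableAt (isOpen_Ioo.mem_nhds hx)).hasDerivAt

theorem exists_continuousOn_eqOn_deriv (hf : Continuous f) (hL : 0 < L)
    (h : IsDirichletSolution f lam L u) :
    ∃ p, ContinuousOn p (Icc 0 L) ∧ EqOn p (deriv u) (Ioo 0 L) := by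
  have hm : L / 2 ∈ Ioo 0 L := ⟨half_pos hL, half_lt_self hL⟩
  have hcont : ContinuousOn (fun x => -(lam * f (u x))) (Icc 0 L) :=
    (continuousOn_const.mul (hf.comp_continuousOn h.continuousOn)).neg
  refine ⟨fun x => deriv u (L / 2) + ∫ t in (L / 2)..x, -(lam * f (u t)), ?_, fun x hx => ?_⟩
  · rw [← uIcc_of_le hL.le] at hcont ⊢
    exact continuousOn_const.add (intervalIntegral.continuousOn_primitive_interval'
      hcont.intervalIntegrable (uIcc_of_le hL.le ▸ Ioo_subset_Icc_self hm))
  · have hsub : uIcc (L / 2) x ⊆ Ioo 0 L := ordConnected_Ioo.uIcc_subset hm hx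
    have hint := intervalIntegral.integral_eq_sub_of_hasDerivAt
      (fun t ht => h.hasDerivAt_deriv (hsub ht))
      (hcont.mono (hsub.trans Ioo_subset_Icc_self)).intervalIntegrable
    simp only [hint, add_sub_cancel]

theorem exists_isPhaseSolution (hf : Continuous f) (hlam : 0 < lam) (hL : 0 < L)
    (h : IsDirichletSolution f lam L u) : ∃ v, IsPhaseSolution f √lam L u v := by
  obtain ⟨p, hp, hpu⟩ := h.exists_continuousOn_eqOn_deriv hf hL
  have hμ : √lam ≠ 0 := (Real.sqrt_pos.2 hlam).ne'
  refine ⟨fun x => p x / √lam, h.continuousOn, hp.div_const _, fun x hx => ?_, fun x hx => ?_,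
    h.left_eq, h.right_eq⟩
  · rw [hpu hx, mul_div_cancel₀ _ hμ]
    exact ((h.contDiffOn.differentiableOn two_ne_zero).differentiableAt
      (isOpen_Ioo.mem_nhds hx)).hasDerivAt
  · have hd := ((h.hasDerivAt_deriv hx).congr_of_eventuallyEq
      (hpu.eventuallyEq_of_mem (isOpen_Ioo.mem_nhds hx))).div_const √lam
    rwa [neg_div, mul_div_right_comm, Real.div_sqrt] at hd

end IsDirichletSolution

theorem mainTheorem3_general (f : ℝ → ℝ) (hf : Continuous f) (hpos : ∀ u, 0 < f u)
    (lam : ℝ) (hlam : 0 < lam) :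
    (Differentiable ℝ f → (∀ u, 0 < u → 0 < gFun f u) →
      StrictMonoOn (timeMap f lam) (primitive f '' Ioi 0) ∧
      ∀ L : ℝ, 0 < L → ∀ u₁ u₂ : ℝ → ℝ,
        IsDirichletSolution f lam L u₁ → IsDirichletSolution f lam L u₂ →
        EqOn u₁ u₂ (Icc 0 L)) ∧
    ∀ L : ℝ, 0 < L →
      (StrictConvexOn ℝ (Ici 0) f → ∀ u₁ u₂ u₃ : ℝ → ℝ, IsDirichletSolution f lam L u₁ →
        IsDirichletSolution f lam L u₂ → IsDirichletSolution f lam L u₃ →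
        EqOn u₁ u₂ (Icc 0 L) ∨ EqOn u₁ u₃ (Icc 0 L) ∨ EqOn u₂ u₃ (Icc 0 L)) ∧
      (∀ u₁ u₂ : ℝ → ℝ, IsDirichletSolution f lam L u₁ → IsDirichletSolution f lam L u₂ →
        ¬ EqOn u₁ u₂ (Icc 0 L) →
        (∀ x ∈ Ioo 0 L, u₁ x < u₂ x) ∨ (∀ x ∈ Ioo 0 L, u₂ x < u₁ x)) := by
  have hμ : 0 < √lam := Real.sqrt_pos.2 hlam
  refine ⟨fun hdiff hg => ?_, fun L hL =>
    ⟨fun hconv u₁ u₂ u₃ hu₁ hu₂ hu₃ => ?_, fun u₁ u₂ hu₁ hu₂ hne => ?_⟩⟩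
  · have hT := strictMonoOn_timeMap hdiff hpos hg hlam
    refine ⟨hT, fun L hL u₁ u₂ hu₁ hu₂ => ?_⟩
    obtain ⟨v₁, h₁⟩ := hu₁.exists_isPhaseSolution hf hlam hL
    obtain ⟨v₂, h₂⟩ := hu₂.exists_isPhaseSolution hf hlam hL
    exact h₁.eqOn_of_snd_zero_eq hf hpos hμ hL h₂
      (h₁.snd_zero_eq_of_injOn_timeMap hf hpos hlam hL hT.injOn h₂)
  · obtain ⟨v₁, h₁⟩ := hu₁.exists_isPhaseSolution hf hlam hL
    obtain ⟨v₂, h₂⟩ := hu₂.exists_isPhaseSolution hf hlam hL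
    obtain ⟨v₃, h₃⟩ := hu₃.exists_isPhaseSolution hf hlam hL
    exact (h₁.snd_zero_eq_or_eq_or_eq hf hpos hconv hμ hL h₂ h₃).imp
      (h₁.eqOn_of_snd_zero_eq hf hpos hμ hL h₂) (Or.imp
        (h₁.eqOn_of_snd_zero_eq hf hpos hμ hL h₃) (h₂.eqOn_of_snd_zero_eq hf hpos hμ hL h₃))
  · obtain ⟨v₁, h₁⟩ := hu₁.exists_isPhaseSolution hf hlam hL
    obtain ⟨v₂, h₂⟩ := hu₂.exists_isPhaseSolution hf hlam hL
    have hv : v₁ 0 ≠ v₂ 0 := fun hv => hne (h₁.eqOn_of_snd_zero_eq hf hpos hμ hL h₂ hv)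
    exact hv.lt_or_gt.imp (fun hlt _ => h₁.fst_lt_of_snd_zero_lt hf hpos hμ hL h₂ hlt)
      (fun hlt _ => h₂.fst_lt_of_snd_zero_lt hf hpos hμ hL h₁ hlt)

theorem mainTheorem3 (f : ℝ → ℝ) (hf : ContDiff ℝ 1 f)
    (hpos : ∀ u, 0 < f u) (hmono : ∀ u, 0 ≤ deriv f u)
    (lam : ℝ) (hlam : 0 < lam) :
    ((∀ u, 0 < u → 0 < gFun f u) →
      StrictMonoOn (timeMap f lam) (Set.Ioi 0) ∧
      ∀ L : ℝ, 0 < L → ∀ u₁ u₂ : ℝ → ℝ,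
        IsDirichletSolution f lam L u₁ → IsDirichletSolution f lam L u₂ →
        Set.EqOn u₁ u₂ (Set.Icc 0 L)) ∧
    (ContDiff ℝ 2 f → (∀ u, 0 < u → 0 < deriv (deriv f) u) →
      ∀ L : ℝ, 0 < L →
        (∀ u₁ u₂ u₃ : ℝ → ℝ, IsDirichletSolution f lam L u₁ →
          IsDirichletSolution f lam L u₂ → IsDirichletSolution f lam L u₃ →
          Set.EqOn u₁ u₂ (Set.Icc 0 L) ∨ Set.EqOn u₁ u₃ (Set.Icc 0 L) ∨
            Set.EqOn u₂ u₃ (Set.Icc 0 L)) ∧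
        (∀ u₁ u₂ : ℝ → ℝ, IsDirichletSolution f lam L u₁ → IsDirichletSolution f lam L u₂ →
          ¬ Set.EqOn u₁ u₂ (Set.Icc 0 L) →
          (∀ x ∈ Set.Ioo 0 L, u₁ x < u₂ x) ∨ (∀ x ∈ Set.Ioo 0 L, u₂ x < u₁ x))) := by
  obtain ⟨hi, hii⟩ := mainTheorem3_general f hf.continuous hpos lam hlam
  have hfm : Monotone f := monotone_of_deriv_nonneg (hf.differentiable one_ne_zero) hmono
  refine ⟨fun hg => (hi (hf.differentiable one_ne_zero) hg).imp_left
    (·.mono (Ioi_zero_subset_image_primitive hf.continuous hpos hfm)), fun _ hf'' L hL =>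
    ⟨(hii L hL).1 (strictConvexOn_of_deriv2_pos (convex_Ici 0) hf.continuous.continuousOn
      fun u hu => hf'' u (interior_Ici.le hu)), (hii L hL).2⟩⟩
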